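/- Let $\mathcal{D}$ be a probability distribution on the non-negative integers with $\mathcal{D}(0)<1$ and finite mean $\lambda:=\mathbb{E}[\mathcal{D}]$. Let $p:=1-\mathcal{D}(0)$, let $\overline{\mathcal{D}}$ be the law $\mathcal{D}$ conditioned on the outcome being nonzero, and let $\overline{\lambda}:=\mathbb{E}[\overline{\mathcal{D}}]$. Write $\oplus$ for convolution of distributions and $\mathcal{D}^{\oplus x}$ for the $x$-fold convolution ($\mathcal{D}^{\oplus 0}$ is the point mass at $0$). The $\mathcal{D}$-repeat channel $\mathsf{Ch}$ receives a finite bit string and replaces each bit, independently, by a number of copies of that bit drawn from $\mathcal{D}$; its output is the resulting bit string. Its capacity is $$\mathsf{Cap}(\mathsf{Ch})=\limsup_{n\to\infty}\ \sup_{X}\ \frac{I(X;Y)}{n},$$ where $X$ ranges over all random $n$-bit strings, $Y$ is the output of the channel on input $X$, and $I$ is mutual information. For a transition rule $\mathcal{P}$ from a discrete input alphabet to the non-negative integers, and for a real $\mu\ge 0$, let $\mathsf{Cap}(\mathsf{Ch}_\mu(\mathcal{P}))$ be the supremum of $I(X;Y)$ over all random inputs $X$ whose corresponding output $Y$ satisfies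 $\mathbb{E}[Y]=\mu$ (and $0$ if there is no such $X$). Let $\mathcal{P}$ be the transition rule on positive integer inputs that maps $1+x$, $x\ge 0$, to a sample from $\overline{\mathcal{D}}\oplus\mathcal{D}^{\oplus x}$, and let $\mathsf{Ch}_\mu(\mathcal{D})$ be the mean-limited channel whose transition rule maps a non-negative integer $x$ to a sample from $\mathcal{D}^{\oplus x}$. Then $$\mathsf{Cap}(\mathsf{Ch})\le\sup_{\mu\ge\overline{\lambda}}\frac{\mathsf{Cap}(\mathsf{Ch}_\mu(\mathcal{P}))}{1/p+(\mu-\overline{\lambda})/\lambda} \qquad\text{and}\qquad \mathsf{Cap}(\mathsf{Ch})\le\sup_{\mu\ge 0}\frac{\mathsf{Cap}(\mathsf{Ch}_\mu(\mathcal{D}))}{1/p+\mu/\lambda}.$$ -/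

import Mathlib

open scoped ENNReal NNReal

namespace RepeatChannel

noncomputable section

/-! A channel with discrete input alphabet `α` and discrete output alphabet `β` is a transition
rule `W : α → PMF β`. Information is measured in nats. -/

/-- Kullback-Leibler divergence between two discrete distributions. -/
def klDivergence {γ : Type*} (p q : PMF γ) : ℝ≥0∞ :=
  letI : MeasurableSpace γ := ⊤
  InformationTheory.klDiv p.toMeasure q.toMeasure

/-- The joint law of `(X, Y)`, where `X` has law `P` and, given `X = x`, `Y` has law `W x`. -/
def jointLaw {α β : Type*} (P : PMF α) (W : α → PMF β) : PMF (α × β) :=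
  P.bind fun x => (W x).map fun y => (x, y)

/-- The mutual information `I(X; Y)` between the input `X`, of law `P`, and the output `Y` of the
channel `W`: the divergence of the joint law from the product of the marginals. The law of `Y` is
`P.bind W`. -/
def mutualInfo {α β : Type*} (P : PMF α) (W : α → PMF β) : ℝ≥0∞ :=
  klDivergence (jointLaw P W) (jointLaw P fun _ => P.bind W)

/-- The expectation of a distribution on the non-negative integers. -/
def mean (D : PMF ℕ) : ℝ≥0∞ := ∑' k, D k * (k : ℝ≥0∞)

/-- The convolution `p ⊕ q`: the law of the sum of independent samples from `p` and `q`. -/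
def conv (p q : PMF ℕ) : PMF ℕ := p.bind fun a => q.map fun b => a + b

/-- The `x`-fold convolution `D^{⊕x}`. -/
def convPow (D : PMF ℕ) : ℕ → PMF ℕ
  | 0 => PMF.pure 0
  | x + 1 => conv D (convPow D x)

/-- The retention probability `p = 1 - D(0)`. -/
def retentionProb (D : PMF ℕ) : ℝ≥0∞ := 1 - D 0

theorem exists_mem_support_of_ne_one {D : PMF ℕ} (hD : D 0 ≠ 1) :
    ∃ k ∈ ({0}ᶜ : Set ℕ), k ∈ D.support := by
  by_contra! h
  apply hD
  rw [PMF.apply_eq_one_iff]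
  apply D.support_nonempty.subset_singleton_iff.mp
  intro k hk
  by_contra hk0
  exact h k hk0 hk

/-- The law `D` conditioned on the outcome being nonzero. -/
def condNonzero (D : PMF ℕ) (hD : D 0 ≠ 1) : PMF ℕ :=
  D.filter {0}ᶜ (exists_mem_support_of_ne_one hD)

/-- The `D`-repeat channel on finite bit strings: each bit is replaced, independently, by a number
of copies of itself drawn from `D`. -/
def repeatChannel (D : PMF ℕ) : List Bool → PMF (List Bool)
  | [] => PMF.pure []
  | b :: bs => D.bind fun k => (repeatChannel D bs).map fun ys => List.replicate k b ++ ys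

/-- The largest mutual information between an `n`-bit input of the `D`-repeat channel and the
corresponding output bit string. -/
def maxInfo (D : PMF ℕ) (n : ℕ) : ℝ≥0∞ :=
  ⨆ P : PMF (Fin n → Bool), mutualInfo P fun x => repeatChannel D (List.ofFn x)

/-- The capacity of the `D`-repeat channel, `lim_n sup_X I(X; Y) / n`. The upper limit is taken, so
that the existence of the limit is not presupposed. -/
def capacity (D : PMF ℕ) : ℝ≥0∞ :=
  Filter.limsup (fun n : ℕ => maxInfo D n / (n : ℝ≥0∞)) Filter.atTop

/-- The capacity of the mean-limited channel `Ch_μ(W)`: the supremum of `I(X; Y)` over all input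
laws whose output law has mean exactly `μ`. -/
def meanLimitedCapacity {α : Type*} (W : α → PMF ℕ) (μ : ℝ≥0) : ℝ≥0∞ :=
  ⨆ (P : PMF α) (_ : mean (P.bind W) = (μ : ℝ≥0∞)), mutualInfo P W

/-- The transition rule on positive integers that maps `1 + x` to `D̄ ⊕ D^{⊕x}`, where `D̄` is `D`
conditioned on being nonzero. -/
def runChannel (D : PMF ℕ) (hD : D 0 ≠ 1) (z : ℕ+) : PMF ℕ :=
  conv (condNonzero D hD) (convPow D ((z : ℕ) - 1))

/-- The convolution channel on non-negative integers, which maps `x` to `D^{⊕x}`. -/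
def convolutionChannel (D : PMF ℕ) (x : ℕ) : PMF ℕ := convPow D x

end

end RepeatChannel

/-! Cut the output of the repeat channel into runs. Given how many input bits contribute to each
run, the run lengths are the outputs of independent uses of the channel `runChannel`, since deleting
bits of the value opposite to the current run leaves no trace. With `p` the retention probability,
a run with input `z` uses up on average `1 / p + (z - 1)` input bits: awaiting a retained bit takes
`1 / p`, the other `z - 1` bits are all counted. As `n` input bits must pay for all runs, the
information per input bit is at most the capacity per unit cost of `runChannel`, up to `O(log n)`
for the number of runs and for an initial, possibly empty run. The output mean of `runChannel` is an
affine function of the expected cost, so the first bound is this capacity sorted by output mean. For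
the second, `runChannel` is the convolution channel followed by the addition of an independent
sample of `condNonzero D`. -/

namespace RepeatChannel

noncomputable section

variable {α β γ ι : Type*}

/-! ### Expectation and joint laws -/

/-- The expectation of a nonnegative function of a random variable with law `P`. -/
def expect (P : PMF α) (f : α → ℝ≥0∞) : ℝ≥0∞ := ∑' x, P x * f x

theorem expect_pure (a : α) (f : α → ℝ≥0∞) : expect (PMF.pure a) f = f a := by
  rw [expect, tsum_eq_single a fun b hb => by rw [PMF.pure_apply_of_ne _ _ hb, zero_mul],
    PMF.pure_apply_self, one_mul]

theorem expect_bind (P : PMF α) (K : α → PMF β) (f : β → ℝ≥0∞) :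
    expect (P.bind K) f = expect P fun x => expect (K x) f := by
  simp_rw [expect, PMF.bind_apply, ← ENNReal.tsum_mul_right, ← ENNReal.tsum_mul_left]
  rw [ENNReal.tsum_comm]
  simp_rw [mul_assoc]

theorem expect_map (P : PMF α) (g : α → β) (f : β → ℝ≥0∞) :
    expect (P.map g) f = expect P (f ∘ g) := by
  simp only [PMF.map, expect_bind, expect_pure, Function.comp_def]

theorem expect_const (P : PMF α) (c : ℝ≥0∞) : expect P (fun _ => c) = c := by
  rw [expect, ENNReal.tsum_mul_right, P.tsum_coe, one_mul]

theorem expect_add (P : PMF α) (f g : α → ℝ≥0∞) :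
    expect P (fun x => f x + g x) = expect P f + expect P g := by
  simp_rw [expect, mul_add, ENNReal.tsum_add]

theorem expect_mul_const (P : PMF α) (f : α → ℝ≥0∞) (c : ℝ≥0∞) :
    expect P (fun x => f x * c) = expect P f * c := by
  simp_rw [expect, ← mul_assoc, ENNReal.tsum_mul_right]

theorem expect_const_mul (P : PMF α) (c : ℝ≥0∞) (f : α → ℝ≥0∞) :
    expect P (fun x => c * f x) = c * expect P f := by
  simp_rw [mul_comm c, expect_mul_const]

theorem expect_mono {P : PMF α} {f g : α → ℝ≥0∞} (h : ∀ x ∈ P.support, f x ≤ g x) :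
    expect P f ≤ expect P g := by
  refine ENNReal.tsum_le_tsum fun x => ?_
  by_cases hx : P x = 0
  · simp only [hx, zero_mul, le_refl]
  · exact mul_le_mul_right (h x hx) _

theorem expect_congr {P : PMF α} {f g : α → ℝ≥0∞} (h : ∀ x ∈ P.support, f x = g x) :
    expect P f = expect P g :=
  (expect_mono fun x hx => (h x hx).le).antisymm (expect_mono fun x hx => (h x hx).ge)

theorem expect_ite (c : Prop) [Decidable c] (P Q : PMF α) (f : α → ℝ≥0∞) :
    expect (if c then P else Q) f = if c then expect P f else expect Q f :=
  apply_ite (expect · f) c P Q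

theorem ne_top_of_mem_support {P : PMF α} {f : α → ℝ≥0∞} (hf : expect P f ≠ ∞) {x : α}
    (hx : x ∈ P.support) : f x ≠ ∞ := fun h =>
  ENNReal.ne_top_of_tsum_ne_top hf x (by rw [h, ENNReal.mul_top hx])

theorem bind_congr_of_mem_support {P : PMF α} {f g : α → PMF β} (h : ∀ x ∈ P.support, f x = g x) :
    P.bind f = P.bind g :=
  PMF.ext fun y => expect_congr fun x hx => by rw [h x hx]

theorem exists_map_eq_of_support_subset_range {f : β → α} {P : PMF α}
    (h : P.support ⊆ Set.range f) : ∃ Q : PMF β, Q.map f = P := by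
  obtain ⟨x₀, hx₀⟩ := P.support_nonempty
  obtain ⟨y₀, -⟩ := h hx₀
  have : Nonempty β := ⟨y₀⟩
  refine ⟨P.map (Function.invFun f), ?_⟩
  rw [PMF.map_comp, PMF.map, bind_congr_of_mem_support (g := PMF.pure), PMF.bind_pure]
  exact fun x hx => congrArg PMF.pure (Function.invFun_eq (h hx))

theorem jointLaw_apply (P : PMF α) (W : α → PMF β) (x : α) (y : β) :
    jointLaw P W (x, y) = P x * W x y := by
  classical
  rw [jointLaw, PMF.bind_apply, tsum_eq_single x]
  · rw [PMF.map_apply, tsum_eq_single y]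
    · simp
    · intro y' hy'
      simp [Ne.symm hy']
  · intro x' hx'
    rw [PMF.map_apply]
    simp [Ne.symm hx']

theorem jointLaw_map_snd (P : PMF α) (W : α → PMF β) :
    (jointLaw P W).map Prod.snd = P.bind W := by
  simp only [jointLaw, PMF.map_bind, PMF.map_comp, Function.comp_def]
  exact congrArg _ (funext fun x => PMF.map_id _)

theorem exists_posterior (P : PMF α) (W : α → PMF β) :
    ∃ V : β → PMF α, ∀ y x, P.bind W y * V y x = P x * W x y := by
  classical
  refine ⟨fun y => if h : ∑' x, P x * W x y = 0 then P else
    PMF.normalize (fun x => P x * W x y) h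
      (PMF.bind_apply P W y ▸ (P.bind W).apply_ne_top y), fun y x => ?_⟩
  rw [PMF.bind_apply]
  dsimp only
  split_ifs with h
  · rw [h, zero_mul, ENNReal.tsum_eq_zero.1 h x]
  · rw [PMF.normalize_apply, mul_left_comm,
      ENNReal.mul_inv_cancel h (PMF.bind_apply P W y ▸ (P.bind W).apply_ne_top y), mul_one]

theorem exists_disintegration (P : PMF α) (g : α → β) :
    ∃ κ : β → PMF α, (P.map g).bind κ = P ∧
      ∀ b ∈ (P.map g).support, ∀ a ∈ (κ b).support, g a = b := by
  obtain ⟨κ, hκ⟩ := exists_posterior P fun a => PMF.pure (g a)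
  refine ⟨κ, PMF.ext fun a => ?_, fun b hb a ha => ?_⟩
  · exact (tsum_congr fun b => hκ b a).trans (by
      rw [ENNReal.tsum_mul_left, PMF.tsum_coe, mul_one])
  · have hba : PMF.pure (g a) b ≠ 0 := right_ne_zero_of_mul (hκ b a ▸ mul_ne_zero hb ha)
    exact ((PMF.mem_support_pure_iff _ _).1 hba).symm

theorem jointLaw_map_swap_apply (P : PMF α) (W : α → PMF β) (x : α) (y : β) :
    (jointLaw P W).map Prod.swap (y, x) = P x * W x y := by
  classical
  rw [← jointLaw_apply, PMF.map_apply, tsum_eq_single (x, y)]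
  · exact if_pos rfl
  · exact fun z hz => if_neg fun h => hz (Prod.swap_injective h.symm)

/-! ### Kullback-Leibler divergence -/

theorem klDivergence_eq_klDiv [MeasurableSpace γ] [DiscreteMeasurableSpace γ] (p q : PMF γ) :
    klDivergence p q = InformationTheory.klDiv p.toMeasure q.toMeasure := by
  obtain rfl : ‹MeasurableSpace γ› = ⊤ := eq_top_iff.2 fun s _ => .of_discrete
  rfl

theorem klDivergence_self (p : PMF γ) : klDivergence p p = 0 :=
  InformationTheory.klDiv_self _

theorem klDivergence_map_le (f : α → β) (p q : PMF α) :
    klDivergence (p.map f) (q.map f) ≤ klDivergence p q := by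
  let _ : MeasurableSpace α := ⊤
  let _ : MeasurableSpace β := ⊤
  have hf : Measurable f := .of_discrete
  simp only [klDivergence_eq_klDiv, ← PMF.toMeasure_map (hf := hf)]
  exact InformationTheory.klDiv_map_le _ _ hf

theorem klDivergence_map_of_leftInverse {f : α → β} {g : β → α} (hfg : Function.LeftInverse g f)
    (p q : PMF α) : klDivergence (p.map f) (q.map f) = klDivergence p q := by
  refine (klDivergence_map_le f p q).antisymm ?_
  simpa only [PMF.map_comp, hfg.comp_eq_id, PMF.map_id] using
    klDivergence_map_le g (p.map f) (q.map f)

section Measure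

variable [MeasurableSpace γ] [MeasurableSingletonClass γ]

theorem absolutelyContinuous_iff_support_subset {p q : PMF γ} :
    p.toMeasure.AbsolutelyContinuous q.toMeasure ↔ p.support ⊆ q.support := by
  refine ⟨fun h x hx hqx => hx ?_, fun h => ?_⟩
  · simpa only [PMF.toMeasure_apply_singleton _ _ (MeasurableSet.singleton x)] using
      @h {x} (by rwa [PMF.toMeasure_apply_singleton _ _ (MeasurableSet.singleton x)])
  · refine MeasureTheory.Measure.AbsolutelyContinuous.mk fun s hs hqs => ?_
    rw [PMF.toMeasure_apply_eq_zero_iff _ hs] at hqs ⊢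
    exact hqs.mono_left h

theorem toMeasure_eq_withDensity [Countable γ] {p q : PMF γ} (h : p.support ⊆ q.support) :
    p.toMeasure = q.toMeasure.withDensity fun x => p x / q x := by
  refine MeasureTheory.Measure.ext_of_singleton fun x => ?_
  rw [MeasureTheory.withDensity_apply _ (MeasurableSet.singleton x),
    MeasureTheory.lintegral_singleton,
    PMF.toMeasure_apply_singleton _ _ (MeasurableSet.singleton _),
    PMF.toMeasure_apply_singleton _ _ (MeasurableSet.singleton _)]
  refine (ENNReal.div_mul_cancel' (fun hq => ?_) fun hq => absurd hq (q.apply_ne_top x)).symm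
  exact not_imp_not.1 (@h x) hq

theorem rnDeriv_toMeasure [Countable γ] {p q : PMF γ} (h : p.support ⊆ q.support) :
    p.toMeasure.rnDeriv q.toMeasure =ᵐ[q.toMeasure] fun x => p x / q x := by
  conv_lhs => rw [toMeasure_eq_withDensity h]
  exact MeasureTheory.Measure.rnDeriv_withDensity _ (measurable_of_countable _)

end Measure

theorem klDivergence_eq_expect_klFun [Countable γ] {p q : PMF γ} (h : p.support ⊆ q.support) :
    klDivergence p q =
      expect q fun x => ENNReal.ofReal (InformationTheory.klFun (p x / q x).toReal) := by
  let _ : MeasurableSpace γ := ⊤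
  rw [klDivergence_eq_klDiv, InformationTheory.klDiv_eq_lintegral_klFun_of_ac
    (absolutelyContinuous_iff_support_subset.2 h),
    MeasureTheory.lintegral_congr_ae ((rnDeriv_toMeasure h).mono fun x hx => by rw [hx]),
    MeasureTheory.lintegral_countable', expect]
  simp only [PMF.toMeasure_apply_singleton _ _ (MeasurableSet.singleton _), mul_comm]

theorem klDivergence_eq_top {p q : PMF γ} (h : ¬ p.support ⊆ q.support) :
    klDivergence p q = ∞ := by
  let _ : MeasurableSpace γ := ⊤
  rw [klDivergence_eq_klDiv]
  exact InformationTheory.klDiv_of_not_ac (mt absolutelyContinuous_iff_support_subset.1 h)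

theorem jointLaw_support_subset_iff {P : PMF α} {W V : α → PMF β} :
    (jointLaw P W).support ⊆ (jointLaw P V).support ↔
      ∀ x ∈ P.support, (W x).support ⊆ (V x).support := by
  simp only [Set.subset_def, Prod.forall, PMF.mem_support_iff, jointLaw_apply, ne_eq,
    mul_eq_zero, not_or]
  exact ⟨fun h x hx y hy => (h x y ⟨hx, hy⟩).2, fun h x y hxy => ⟨hxy.1, h x hxy.1 y hxy.2⟩⟩

theorem klDivergence_jointLaw_left [Countable α] [Countable β] (P : PMF α) (W V : α → PMF β) :
    klDivergence (jointLaw P W) (jointLaw P V) =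
      expect P fun x => klDivergence (W x) (V x) := by
  by_cases h : ∀ x ∈ P.support, (W x).support ⊆ (V x).support
  · rw [klDivergence_eq_expect_klFun (jointLaw_support_subset_iff.2 h),
      expect_congr fun x hx => klDivergence_eq_expect_klFun (h x hx)]
    simp only [jointLaw, expect_bind, expect_map]
    refine expect_congr fun x hx => expect_congr fun y _ => ?_
    simp only [← jointLaw.eq_1, Function.comp_apply, jointLaw_apply,
      ENNReal.mul_div_mul_left _ _ hx (P.apply_ne_top x)]
  · rw [klDivergence_eq_top (mt jointLaw_support_subset_iff.1 h)]
    push Not at h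
    obtain ⟨x, hx, hWV⟩ := h
    by_contra hne
    exact ne_top_of_mem_support (Ne.symm hne) hx (klDivergence_eq_top hWV)

theorem toMeasure_jointLaw [MeasurableSpace α] [DiscreteMeasurableSpace α] [Countable α]
    [MeasurableSpace β] [MeasurableSingletonClass β] [Countable β] (P : PMF α) (W : α → PMF β) :
    (jointLaw P W).toMeasure =
      P.toMeasure.compProd ⟨fun x => (W x).toMeasure, .of_discrete⟩ := by
  let κ : ProbabilityTheory.Kernel α β := ⟨fun x => (W x).toMeasure, .of_discrete⟩
  have : ProbabilityTheory.IsMarkovKernel κ := ⟨fun x => PMF.toMeasure.isProbabilityMeasure (W x)⟩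
  refine MeasureTheory.Measure.ext_of_singleton fun ⟨x, y⟩ => ?_
  rw [PMF.toMeasure_apply_singleton _ _ (MeasurableSet.singleton _), jointLaw_apply,
    ← Set.singleton_prod_singleton, MeasureTheory.Measure.compProd_apply_prod
      (MeasurableSet.singleton x) (MeasurableSet.singleton y), MeasureTheory.lintegral_singleton,
    PMF.toMeasure_apply_singleton _ _ (MeasurableSet.singleton _), mul_comm]
  exact congrArg (· * P x) (PMF.toMeasure_apply_singleton _ _ (MeasurableSet.singleton _)).symm

theorem klDivergence_jointLaw [Countable α] [Countable β] (P Q : PMF α) (W V : α → PMF β) :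
    klDivergence (jointLaw P W) (jointLaw Q V) =
      klDivergence P Q + expect P fun x => klDivergence (W x) (V x) := by
  let _ : MeasurableSpace α := ⊤
  let _ : MeasurableSpace β := ⊤
  let κ (W : α → PMF β) : ProbabilityTheory.Kernel α β :=
    ⟨fun x => (W x).toMeasure, .of_discrete⟩
  have hκ (W : α → PMF β) : ProbabilityTheory.IsMarkovKernel (κ W) :=
    ⟨fun x => PMF.toMeasure.isProbabilityMeasure (W x)⟩
  rw [← klDivergence_jointLaw_left]
  simp only [klDivergence_eq_klDiv, toMeasure_jointLaw]
  exact InformationTheory.klDiv_compProd_eq_add P.toMeasure Q.toMeasure (κ W) (κ V)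

theorem klDivergence_bind_bind_le [Countable α] [Countable β] (P Q : PMF α) (W V : α → PMF β) :
    klDivergence (P.bind W) (Q.bind V) ≤
      klDivergence P Q + expect P fun x => klDivergence (W x) (V x) := by
  rw [← klDivergence_jointLaw, ← jointLaw_map_snd P, ← jointLaw_map_snd Q]
  exact klDivergence_map_le _ _ _

theorem klDivergence_bind_le [Countable α] [Countable β] (P Q : PMF α) (K : α → PMF β) :
    klDivergence (P.bind K) (Q.bind K) ≤ klDivergence P Q := by
  simpa only [klDivergence_self, expect_const, add_zero] using klDivergence_bind_bind_le P Q K K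

theorem klDivergence_pure [Countable α] {Q : PMF α} {a : α} (ha : Q a ≠ 0) :
    klDivergence (PMF.pure a) Q = ENNReal.ofReal (-Real.log (Q a).toReal) := by
  let _ : MeasurableSpace α := ⊤
  have hsub : (PMF.pure a).support ⊆ Q.support := by
    rwa [PMF.support_pure, Set.singleton_subset_iff]
  have hrn : (PMF.pure a).toMeasure.rnDeriv Q.toMeasure a = (Q a)⁻¹ := by
    have hQa : Q.toMeasure {a} ≠ 0 := by
      rwa [PMF.toMeasure_apply_singleton _ _ (MeasurableSet.singleton _)]
    simpa only [PMF.pure_apply_self, one_div] using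
      MeasureTheory.ae_iff_of_countable.1 (rnDeriv_toMeasure hsub) a hQa
  rw [klDivergence_eq_klDiv, InformationTheory.klDiv_of_ac_of_integrable
    (absolutelyContinuous_iff_support_subset.2 hsub)]
  · simp only [MeasureTheory.llr, PMF.toMeasure_pure, MeasureTheory.integral_dirac,
      MeasureTheory.probReal_univ, add_sub_cancel_right]
    rw [← PMF.toMeasure_pure, hrn, ENNReal.toReal_inv, Real.log_inv]
  · rw [PMF.toMeasure_pure]
    exact MeasureTheory.integrable_dirac enorm_lt_top

/-! ### Mutual information -/

theorem mutualInfo_eq_expect [Countable α] [Countable β] (P : PMF α) (W : α → PMF β) :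
    mutualInfo P W = expect P fun x => klDivergence (W x) (P.bind W) :=
  klDivergence_jointLaw_left _ _ _

/-- Both sides are the divergence of the joint law from `P × Q`, disintegrated over the output and
over the input. -/
theorem mutualInfo_add_klDivergence [Countable α] [Countable β] (P : PMF α) (W : α → PMF β)
    (Q : PMF β) :
    mutualInfo P W + klDivergence (P.bind W) Q = expect P fun x => klDivergence (W x) Q := by
  obtain ⟨V, hV⟩ := exists_posterior P W
  have hswap : (jointLaw P W).map Prod.swap = jointLaw (P.bind W) V :=
    PMF.ext fun ⟨y, x⟩ => by rw [jointLaw_map_swap_apply, jointLaw_apply, hV]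
  have hswap_prod (R : PMF β) :
      (jointLaw P fun _ => R).map Prod.swap = jointLaw R fun _ => P :=
    PMF.ext fun ⟨y, x⟩ => by rw [jointLaw_map_swap_apply, jointLaw_apply, mul_comm]
  have hkl (R : PMF β) : klDivergence (jointLaw P W) (jointLaw P fun _ => R) =
      klDivergence (P.bind W) R + expect (P.bind W) fun y => klDivergence (V y) P := by
    rw [← klDivergence_map_of_leftInverse Prod.swap_leftInverse, hswap, hswap_prod,
      klDivergence_jointLaw]
  rw [← klDivergence_jointLaw_left, mutualInfo, hkl, hkl, klDivergence_self, zero_add, add_comm]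

theorem mutualInfo_le_expect [Countable α] [Countable β] (P : PMF α) (W : α → PMF β)
    (Q : PMF β) : mutualInfo P W ≤ expect P fun x => klDivergence (W x) Q :=
  le_self_add.trans_eq (mutualInfo_add_klDivergence P W Q)

theorem mutualInfo_map [Countable α] [Countable β] [Countable γ] (P : PMF α) (f : α → β)
    (W : β → PMF γ) : mutualInfo (P.map f) W = mutualInfo P (W ∘ f) := by
  simp only [mutualInfo_eq_expect, expect_map, PMF.bind_map, Function.comp_def]

theorem mutualInfo_bind_output_le [Countable α] [Countable β] [Countable γ] (P : PMF α)
    (W : α → PMF β) (K : β → PMF γ) : mutualInfo P (fun x => (W x).bind K) ≤ mutualInfo P W := by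
  simp only [mutualInfo_eq_expect, ← PMF.bind_bind]
  exact expect_mono fun x _ => klDivergence_bind_le _ _ _

theorem mutualInfo_bind_input_le [Countable α] [Countable β] [Countable γ] (P : PMF α)
    (K : α → PMF β) (W : β → PMF γ) :
    mutualInfo P (fun x => (K x).bind W) ≤ mutualInfo (P.bind K) W := by
  simp only [mutualInfo_eq_expect, ← PMF.bind_bind, expect_bind]
  refine expect_mono fun x _ => ?_
  simpa only [PMF.bind_const, klDivergence_self, zero_add] using
    klDivergence_bind_bind_le (K x) (K x) W fun _ => (P.bind K).bind W

theorem klDivergence_uniform_bind_le [Countable α] [Countable ι] {s : Finset ι} {i : ι}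
    (hi : i ∈ s) (p : PMF α) (q : ι → PMF α) :
    klDivergence p ((PMF.uniformOfFinset s ⟨i, hi⟩).bind q) ≤
      ENNReal.ofReal (Real.log s.card) + klDivergence p (q i) := by
  have hUi : PMF.uniformOfFinset s ⟨i, hi⟩ i = (s.card : ℝ≥0∞)⁻¹ :=
    PMF.uniformOfFinset_apply_of_mem ⟨i, hi⟩ hi
  have h := klDivergence_bind_bind_le (PMF.pure i) (PMF.uniformOfFinset s ⟨i, hi⟩) (fun _ => p) q
  rwa [PMF.bind_const, expect_pure, klDivergence_pure
    (hUi.trans_ne (ENNReal.inv_ne_zero.2 (ENNReal.natCast_ne_top _))), hUi, ENNReal.toReal_inv,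
    Real.log_inv, neg_neg, ENNReal.toReal_natCast] at h

/-- The output law is compared with the uniform mixture of the output laws of the components, which
dominates each of them up to the factor `#s`. -/
theorem mutualInfo_bind_le_add_log_card [Countable α] [Countable β] [Countable ι] {s : Finset ι}
    {μ : PMF ι} (hμ : μ.support ⊆ s) (κ : ι → PMF α) (W : α → PMF β) :
    mutualInfo (μ.bind κ) W ≤
      ENNReal.ofReal (Real.log s.card) + expect μ fun i => mutualInfo (κ i) W := by
  obtain ⟨i₀, hi₀⟩ := μ.support_nonempty
  have hs : s.Nonempty := ⟨i₀, hμ hi₀⟩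
  let U := (PMF.uniformOfFinset s hs).bind fun i => (κ i).bind W
  calc mutualInfo (μ.bind κ) W
      ≤ expect (μ.bind κ) fun x => klDivergence (W x) U := mutualInfo_le_expect _ _ _
    _ = expect μ fun i => expect (κ i) fun x => klDivergence (W x) U := expect_bind _ _ _
    _ ≤ expect μ fun i => expect (κ i) fun x =>
          ENNReal.ofReal (Real.log s.card) + klDivergence (W x) ((κ i).bind W) :=
        expect_mono fun i hi => expect_mono fun x _ =>
          klDivergence_uniform_bind_le (hμ hi) (W x) fun i => (κ i).bind W
    _ = ENNReal.ofReal (Real.log s.card) + expect μ fun i => mutualInfo (κ i) W := by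
        simp only [expect_add, expect_const, mutualInfo_eq_expect]

theorem mutualInfo_pure [Countable α] [Countable β] (a : α) (W : α → PMF β) :
    mutualInfo (PMF.pure a) W = 0 := by
  rw [mutualInfo_eq_expect, expect_pure, PMF.pure_bind, klDivergence_self]

theorem mutualInfo_le_log_card [Countable α] [Countable β] {s : Finset α} {P : PMF α}
    (hP : P.support ⊆ s) (W : α → PMF β) : mutualInfo P W ≤ ENNReal.ofReal (Real.log s.card) := by
  simpa only [PMF.bind_pure, mutualInfo_pure, expect_const, add_zero] using
    mutualInfo_bind_le_add_log_card hP PMF.pure W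

/-- The law of a pair of independent samples from `p` and `q`. -/
def prodLaw (p : PMF α) (q : PMF β) : PMF (α × β) := jointLaw p fun _ => q

theorem prodLaw_bind (p : PMF α) (q : PMF β) (f : α × β → PMF γ) :
    (prodLaw p q).bind f = p.bind fun x => q.bind fun y => f (x, y) := by
  simp only [prodLaw, jointLaw, PMF.bind_bind, PMF.bind_map, Function.comp_def]

theorem klDivergence_prodLaw [Countable α] [Countable β] (p p' : PMF α) (q q' : PMF β) :
    klDivergence (prodLaw p q) (prodLaw p' q') = klDivergence p p' + klDivergence q q' := by
  rw [prodLaw, prodLaw, klDivergence_jointLaw, expect_const]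

theorem mutualInfo_prodLaw_le {α' β' : Type*} [Countable α] [Countable β] [Countable α']
    [Countable β'] (R : PMF (α × α')) (W : α → PMF β) (V : α' → PMF β') :
    mutualInfo R (fun z => prodLaw (W z.1) (V z.2)) ≤
      mutualInfo (R.map Prod.fst) W + mutualInfo (R.map Prod.snd) V := by
  refine (mutualInfo_le_expect _ _ (prodLaw ((R.map Prod.fst).bind W)
    ((R.map Prod.snd).bind V))).trans_eq ?_
  simp only [klDivergence_prodLaw, expect_add, mutualInfo_eq_expect, expect_map, Function.comp_def]

/-! ### Capacity per unit cost -/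

/-- The capacity of the channel `W` per unit of expected input cost. -/
def capacityPerUnitCost (W : α → PMF β) (cost : α → ℝ≥0∞) : ℝ≥0∞ :=
  ⨆ (R : PMF α) (_ : expect R cost ≠ ∞), mutualInfo R W / expect R cost

theorem mutualInfo_le_capacityPerUnitCost_mul (W : α → PMF β) {cost : α → ℝ≥0∞}
    (hcost : ∀ x, cost x ≠ 0) {R : PMF α} (hR : expect R cost ≠ ∞) :
    mutualInfo R W ≤ capacityPerUnitCost W cost * expect R cost := by
  have hR0 : expect R cost ≠ 0 := fun h => by
    obtain ⟨x, hx⟩ := R.support_nonempty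
    exact mul_ne_zero hx (hcost x) (ENNReal.tsum_eq_zero.1 h x)
  rw [← ENNReal.div_le_iff hR0 hR]
  exact le_iSup₂_of_le R hR le_rfl

/-- The memoryless extension of the channel `W` to finite sequences of inputs. -/
def listChannel (W : α → PMF β) : List α → PMF (List β)
  | [] => PMF.pure []
  | x :: l => (prodLaw (W x) (listChannel W l)).map fun z => z.1 :: z.2

/-- The total cost of a finite sequence of inputs. -/
def listCost (cost : α → ℝ≥0∞) (l : List α) : ℝ≥0∞ := (l.map cost).sum

theorem mutualInfo_listChannel_le_of_length_eq [Countable α] [Countable β] (W : α → PMF β)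
    {cost : α → ℝ≥0∞} (hcost : ∀ x, cost x ≠ 0) (m : ℕ) {R : PMF (List α)}
    (hlen : ∀ l ∈ R.support, l.length = m) (hR : expect R (listCost cost) ≠ ∞) :
    mutualInfo R (listChannel W) ≤ capacityPerUnitCost W cost * expect R (listCost cost) := by
  induction m generalizing R with
  | zero =>
    have hnil : R = PMF.pure [] := by
      rw [← R.bind_pure, bind_congr_of_mem_support (g := fun _ => PMF.pure []), PMF.bind_const]
      exact fun l hl => by rw [List.length_eq_zero_iff.1 (hlen l hl)]
    rw [hnil, mutualInfo_pure]
    exact zero_le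
  | succ m ih =>
    obtain ⟨R', rfl⟩ : ∃ R' : PMF (α × List α), R'.map (fun z => z.1 :: z.2) = R :=
      exists_map_eq_of_support_subset_range fun l hl => by
        obtain ⟨x, l', rfl⟩ := List.exists_cons_of_length_eq_add_one (hlen l hl)
        exact ⟨(x, l'), rfl⟩
    have hsplit : expect (R'.map fun z => z.1 :: z.2) (listCost cost) =
        expect (R'.map Prod.fst) cost + expect (R'.map Prod.snd) (listCost cost) := by
      simp only [expect_map, ← expect_add, Function.comp_def, listCost, List.map_cons,
        List.sum_cons]
    have hlen' : ∀ l ∈ (R'.map Prod.snd).support, l.length = m := by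
      simp only [PMF.support_map, Set.forall_mem_image] at hlen ⊢
      exact fun z hz => Nat.succ_injective (hlen hz)
    rw [hsplit] at hR ⊢
    rw [ENNReal.add_ne_top] at hR
    calc mutualInfo (R'.map fun z => z.1 :: z.2) (listChannel W)
        = mutualInfo R' fun z =>
            (prodLaw (W z.1) (listChannel W z.2)).map fun z => z.1 :: z.2 := mutualInfo_map _ _ _
      _ ≤ mutualInfo R' fun z => prodLaw (W z.1) (listChannel W z.2) :=
          mutualInfo_bind_output_le _ _ _
      _ ≤ mutualInfo (R'.map Prod.fst) W + mutualInfo (R'.map Prod.snd) (listChannel W) :=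
          mutualInfo_prodLaw_le _ _ _
      _ ≤ capacityPerUnitCost W cost * expect (R'.map Prod.fst) cost +
            capacityPerUnitCost W cost * expect (R'.map Prod.snd) (listCost cost) :=
          add_le_add (mutualInfo_le_capacityPerUnitCost_mul W hcost hR.1) (ih hlen' hR.2)
      _ = _ := (mul_add _ _ _).symm

theorem mutualInfo_listChannel_le [Countable α] [Countable β] (W : α → PMF β)
    {cost : α → ℝ≥0∞} (hcost : ∀ x, cost x ≠ 0) {n : ℕ} {R : PMF (List α)}
    (hlen : ∀ l ∈ R.support, l.length ≤ n) (hR : expect R (listCost cost) ≠ ∞) :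
    mutualInfo R (listChannel W) ≤
      ENNReal.ofReal (Real.log (n + 1 : ℕ)) +
        capacityPerUnitCost W cost * expect R (listCost cost) := by
  obtain ⟨κ, hκ, hκlen⟩ := exists_disintegration R List.length
  have hlength : (R.map List.length).support ⊆ Finset.range (n + 1) := by
    simp only [PMF.support_map, Set.image_subset_iff]
    exact fun l hl => Finset.mem_coe.2 (Finset.mem_range_succ_iff.2 (hlen l hl))
  have hcond : expect R (listCost cost) =
      expect (R.map List.length) fun m => expect (κ m) (listCost cost) := by
    rw [← expect_bind, hκ]
  rw [hcond] at hR ⊢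
  calc mutualInfo R (listChannel W)
      = mutualInfo ((R.map List.length).bind κ) (listChannel W) := by rw [hκ]
    _ ≤ ENNReal.ofReal (Real.log (Finset.range (n + 1)).card) +
          expect (R.map List.length) fun m => mutualInfo (κ m) (listChannel W) :=
        mutualInfo_bind_le_add_log_card hlength _ _
    _ ≤ ENNReal.ofReal (Real.log (Finset.range (n + 1)).card) +
          expect (R.map List.length) fun m =>
            capacityPerUnitCost W cost * expect (κ m) (listCost cost) := by
        gcongr
        exact expect_mono fun m hm => mutualInfo_listChannel_le_of_length_eq W hcost m
          (hκlen m hm) (ne_top_of_mem_support hR hm)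
    _ = _ := by rw [Finset.card_range, expect_const_mul]

/-! ### The repeat channel -/

section Retention

variable {D : PMF ℕ}

theorem retentionProb_ne_zero (hD : D 0 ≠ 1) : retentionProb D ≠ 0 :=
  (tsub_pos_of_lt (lt_of_le_of_ne (D.coe_le_one 0) hD)).ne'

theorem retentionProb_ne_top (D : PMF ℕ) : retentionProb D ≠ ∞ :=
  ne_top_of_le_ne_top ENNReal.one_ne_top tsub_le_self

theorem apply_zero_add_retentionProb (D : PMF ℕ) : D 0 + retentionProb D = 1 :=
  add_tsub_cancel_of_le (D.coe_le_one 0)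

theorem tsum_succ_eq_retentionProb (D : PMF ℕ) : ∑' k, D (k + 1) = retentionProb D := by
  refine (ENNReal.sub_eq_of_eq_add_rev (D.apply_ne_top 0) ?_).symm
  rw [← D.tsum_coe, tsum_eq_zero_add' ENNReal.summable]

theorem condNonzero_zero (hD : D 0 ≠ 1) : condNonzero D hD 0 = 0 :=
  PMF.filter_apply_eq_zero_of_notMem _ fun h => h rfl

theorem condNonzero_succ (hD : D 0 ≠ 1) (k : ℕ) :
    condNonzero D hD (k + 1) = D (k + 1) * (retentionProb D)⁻¹ := by
  rw [condNonzero, PMF.filter_apply, Set.indicator_of_mem (Nat.succ_ne_zero k),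
    ← tsum_succ_eq_retentionProb, tsum_eq_zero_add' ENNReal.summable]
  simp

theorem expect_eq_add_expect_condNonzero (hD : D 0 ≠ 1) (f : ℕ → ℝ≥0∞) :
    expect D f = D 0 * f 0 + retentionProb D * expect (condNonzero D hD) f := by
  rw [expect, expect, tsum_eq_zero_add' ENNReal.summable,
    tsum_eq_zero_add' (f := fun k => condNonzero D hD k * f k) ENNReal.summable,
    condNonzero_zero, zero_mul, zero_add, ← ENNReal.tsum_mul_left]
  refine congrArg _ (tsum_congr fun k => ?_)
  rw [condNonzero_succ, mul_comm (D (k + 1)) _⁻¹, ← mul_assoc, ← mul_assoc,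
    ENNReal.mul_inv_cancel (retentionProb_ne_zero hD) (retentionProb_ne_top D), one_mul]

theorem expect_ite_zero (D : PMF ℕ) (a b : ℝ≥0∞) :
    expect D (fun k => if k = 0 then a else b) = D 0 * a + retentionProb D * b := by
  rw [expect, tsum_eq_zero_add' ENNReal.summable]
  simp only [if_pos, Nat.succ_ne_zero, if_false, ENNReal.tsum_mul_right, tsum_succ_eq_retentionProb]

theorem bind_eq_bind_ite_condNonzero (hD : D 0 ≠ 1) (f : ℕ → PMF α) :
    D.bind f = D.bind fun k => if k = 0 then f 0 else (condNonzero D hD).bind f := by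
  refine PMF.ext fun y => ?_
  calc expect D (fun k => f k y)
      = D 0 * f 0 y + retentionProb D * (condNonzero D hD).bind f y :=
        expect_eq_add_expect_condNonzero hD _
    _ = expect D fun k => if k = 0 then f 0 y else (condNonzero D hD).bind f y :=
        (expect_ite_zero D _ _).symm
    _ = _ := expect_congr fun k _ => (apply_ite (fun p : PMF α => p y) _ _ _).symm

theorem mean_eq_retentionProb_mul (hD : D 0 ≠ 1) :
    mean D = retentionProb D * mean (condNonzero D hD) := by
  refine (expect_eq_add_expect_condNonzero hD _).trans ?_
  rw [Nat.cast_zero, mul_zero, zero_add]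
  rfl

theorem mean_ne_zero (hD : D 0 ≠ 1) : mean D ≠ 0 := fun h => by
  refine retentionProb_ne_zero hD ?_
  rw [← tsum_succ_eq_retentionProb, ENNReal.tsum_eq_zero]
  exact fun k => (mul_eq_zero.1 (ENNReal.tsum_eq_zero.1 h (k + 1))).resolve_right
    (Nat.cast_ne_zero.2 k.succ_ne_zero)

theorem mean_condNonzero_ne_top (hD : D 0 ≠ 1) (hmean : mean D ≠ ∞) :
    mean (condNonzero D hD) ≠ ∞ := fun h =>
  hmean (by rw [mean_eq_retentionProb_mul hD, h, ENNReal.mul_top (retentionProb_ne_zero hD)])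

end Retention

theorem mean_bind (P : PMF α) (W : α → PMF ℕ) : mean (P.bind W) = expect P (mean ∘ W) :=
  expect_bind P W _

theorem mean_conv (p q : PMF ℕ) : mean (conv p q) = mean p + mean q := by
  have hmap (a : ℕ) : mean (q.map fun b => a + b) = a + mean q := by
    refine (expect_map q _ _).trans ?_
    simp only [Function.comp_def, Nat.cast_add, expect_add, expect_const]
    rfl
  rw [conv, mean_bind]
  simp only [Function.comp_def, hmap, expect_add, expect_const]
  rfl

theorem mean_convPow (D : PMF ℕ) (x : ℕ) : mean (convPow D x) = x * mean D := by
  induction x with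
  | zero => exact (expect_pure 0 _).trans (by rw [Nat.cast_zero, zero_mul])
  | succ x ih => rw [convPow, mean_conv, ih, Nat.cast_succ, add_one_mul, add_comm]

theorem conv_bind (p q : PMF ℕ) (f : ℕ → PMF α) :
    (conv p q).bind f = p.bind fun a => q.bind fun b => f (a + b) := by
  simp only [conv, PMF.bind_bind, PMF.bind_map, Function.comp_def]

/-- How the `D`-repeat channel groups an input string into output runs when the string follows an
output run of value `b`: the law of `(x, l)`, where `x` counts the input bits that prolong that run
and `l` lists, for each later run, the input bits that contribute to it, starting with its first
retained bit. A bit whose value is that of the current run counts whether or not it is deleted, so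
that its number of copies stays distributed as `D` given `(x, l)`; a bit of the opposite value is
skipped if it is deleted, and starts a new run otherwise. -/
def runDecomposition (D : PMF ℕ) : Bool → List Bool → PMF (ℕ × List ℕ+)
  | _, [] => PMF.pure (0, [])
  | b, c :: cs =>
    if c = b then (runDecomposition D b cs).map fun z => (z.1 + 1, z.2)
    else D.bind fun k =>
      if k = 0 then runDecomposition D b cs
      else (runDecomposition D c cs).map fun z => (0, z.1.succPNat :: z.2)

/-- The bit string made of runs of the given lengths, with alternating values starting from `b`. -/
def ofRunLengths : Bool → List ℕ → List Bool
  | _, [] => []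
  | b, k :: ks => List.replicate k b ++ ofRunLengths (!b) ks

/-- The output of the repeat channel given the run decomposition `(x, l)` of its input. -/
def runOutput (D : PMF ℕ) (hD : D 0 ≠ 1) (b : Bool) (z : ℕ × List ℕ+) : PMF (List Bool) :=
  (prodLaw (convPow D z.1) (listChannel (runChannel D hD) z.2)).map fun w =>
    ofRunLengths b (w.1 :: w.2)

theorem runOutput_succ (D : PMF ℕ) (hD : D 0 ≠ 1) (b : Bool) (x : ℕ) (l : List ℕ+) :
    runOutput D hD b (x + 1, l) =
      D.bind fun k => (runOutput D hD b (x, l)).map (List.replicate k b ++ ·) := by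
  simp only [runOutput, PMF.map_comp]
  simp only [PMF.map, prodLaw_bind, convPow, conv_bind, Function.comp_def, ofRunLengths,
    List.replicate_add, List.append_assoc]

theorem runOutput_zero_cons (D : PMF ℕ) (hD : D 0 ≠ 1) (b : Bool) (x : ℕ) (l : List ℕ+) :
    runOutput D hD b (0, x.succPNat :: l) =
      (condNonzero D hD).bind fun k =>
        (runOutput D hD (!b) (x, l)).map (List.replicate k (!b) ++ ·) := by
  simp only [runOutput, PMF.map_comp]
  simp only [PMF.map, prodLaw_bind, convPow, PMF.pure_bind, listChannel, PMF.bind_bind, runChannel,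
    Nat.succPNat_coe, Nat.succ_sub_one, conv_bind, Function.comp_def, ofRunLengths,
    List.replicate_zero, List.nil_append, List.replicate_add, List.append_assoc]

theorem repeatChannel_eq_runDecomposition_bind {D : PMF ℕ} (hD : D 0 ≠ 1) (b : Bool)
    (cs : List Bool) : repeatChannel D cs = (runDecomposition D b cs).bind (runOutput D hD b) := by
  induction cs generalizing b with
  | nil =>
    simp only [repeatChannel, runDecomposition, PMF.pure_bind, runOutput, PMF.map, prodLaw_bind,
      convPow, listChannel, Function.comp_def, ofRunLengths, List.replicate_zero, List.nil_append]
  | cons c cs ih =>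
    by_cases hcb : c = b
    · subst hcb
      simp only [repeatChannel, runDecomposition, if_true, PMF.bind_map, Function.comp_def,
        runOutput_succ, ih c, PMF.map_bind]
      exact PMF.bind_comm _ _ _
    · obtain rfl : c = !b := Bool.eq_not.2 hcb
      rw [repeatChannel, runDecomposition, if_neg hcb, PMF.bind_bind,
        bind_eq_bind_ite_condNonzero hD]
      refine congrArg _ (funext fun k => ?_)
      split_ifs
      · rw [← ih b]
        exact PMF.map_id _
      · simp only [PMF.bind_map, Function.comp_def, runOutput_zero_cons, ih (!b), PMF.map_bind]
        exact PMF.bind_comm _ _ _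

/-- The expected number of bits that the repeat channel reads for an output run to which `z` of
them contribute: `1 / p` until the first one is retained, which includes that bit, and then
`z - 1`. -/
def runCost (D : PMF ℕ) (z : ℕ+) : ℝ≥0∞ := (retentionProb D)⁻¹ + z.natPred

theorem runCost_ne_zero (D : PMF ℕ) (z : ℕ+) : runCost D z ≠ 0 := fun h =>
  ENNReal.inv_ne_zero.2 (retentionProb_ne_top D) (add_eq_zero.1 h).1

theorem expect_runDecomposition {D : PMF ℕ} (hD : D 0 ≠ 1) (b : Bool) (cs : List Bool) :
    expect (runDecomposition D b cs) (fun z => z.1 + listCost (runCost D) z.2) = cs.length := by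
  induction cs generalizing b with
  | nil =>
    simp only [runDecomposition, expect_pure, listCost, List.map_nil, List.sum_nil, Nat.cast_zero,
      List.length_nil, add_zero]
  | cons c cs ih =>
    rw [List.length_cons, Nat.cast_succ, runDecomposition]
    split_ifs with hcb
    · have hcost (z : ℕ × List ℕ+) : ((z.1 + 1 : ℕ) : ℝ≥0∞) + listCost (runCost D) z.2 =
          (z.1 + listCost (runCost D) z.2) + 1 := by rw [Nat.cast_succ, add_right_comm]
      simp only [expect_map, Function.comp_def, hcost, expect_add (g := fun _ => 1), expect_const,
        ih]
    · have hcost (z : ℕ × List ℕ+) :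
          ((0 : ℕ) : ℝ≥0∞) + listCost (runCost D) (z.1.succPNat :: z.2) =
            (z.1 + listCost (runCost D) z.2) + (retentionProb D)⁻¹ := by
        rw [Nat.cast_zero, zero_add, listCost, List.map_cons, List.sum_cons, runCost,
          Nat.natPred_succPNat, ← listCost]
        ring
      simp only [expect_bind, expect_ite, expect_map, Function.comp_def, hcost,
        expect_add (g := fun _ => (retentionProb D)⁻¹), expect_const, ih]
      rw [expect_ite_zero, mul_add, ← add_assoc, ← add_mul, apply_zero_add_retentionProb, one_mul,
        ENNReal.mul_inv_cancel (retentionProb_ne_zero hD) (retentionProb_ne_top D)]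

theorem add_length_le_of_mem_support_runDecomposition {D : PMF ℕ} {b : Bool} {cs : List Bool}
    {z : ℕ × List ℕ+} (hz : z ∈ (runDecomposition D b cs).support) :
    z.1 + z.2.length ≤ cs.length := by
  induction cs generalizing b z with
  | nil =>
    rw [runDecomposition, PMF.mem_support_pure_iff] at hz
    rw [hz, List.length_nil, List.length_nil]
  | cons c cs ih =>
    rw [List.length_cons]
    rw [runDecomposition] at hz
    split_ifs at hz with hcb
    · obtain ⟨w, hw, rfl⟩ := (PMF.mem_support_map_iff _ _ _).1 hz
      have := ih hw
      lia
    · obtain ⟨k, -, hk⟩ := (PMF.mem_support_bind_iff _ _ _).1 hz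
      split_ifs at hk
      · exact (ih hk).trans (Nat.le_succ _)
      · obtain ⟨w, hw, rfl⟩ := (PMF.mem_support_map_iff _ _ _).1 hk
        have := ih hw
        rw [List.length_cons]
        lia

theorem mutualInfo_runOutput_le {D : PMF ℕ} (hD : D 0 ≠ 1) (b : Bool) {n : ℕ}
    {L : PMF (ℕ × List ℕ+)} (hlen : ∀ z ∈ L.support, z.1 + z.2.length ≤ n)
    (hcost : expect L (fun z => z.1 + listCost (runCost D) z.2) ≤ n) :
    mutualInfo L (runOutput D hD b) ≤
      capacityPerUnitCost (runChannel D hD) (runCost D) * n +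
        2 * ENNReal.ofReal (Real.log (n + 1 : ℕ)) := by
  have hruns : expect (L.map Prod.snd) (listCost (runCost D)) ≤ n := by
    rw [expect_map]
    exact (expect_mono fun z _ => le_add_self).trans hcost
  have hfst : (L.map Prod.fst).support ⊆ Finset.range (n + 1) := by
    rw [PMF.support_map, Set.image_subset_iff]
    exact fun z hz => Finset.mem_coe.2
      (Finset.mem_range_succ_iff.2 (le_self_add.trans (hlen z hz)))
  have hsnd (l) (hl : l ∈ (L.map Prod.snd).support) : l.length ≤ n := by
    obtain ⟨z, hz, rfl⟩ := (PMF.mem_support_map_iff _ _ _).1 hl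
    exact le_add_self.trans (hlen z hz)
  calc mutualInfo L (runOutput D hD b)
      ≤ mutualInfo L fun z => prodLaw (convPow D z.1) (listChannel (runChannel D hD) z.2) :=
        mutualInfo_bind_output_le _ _ _
    _ ≤ mutualInfo (L.map Prod.fst) (convPow D) +
          mutualInfo (L.map Prod.snd) (listChannel (runChannel D hD)) :=
        mutualInfo_prodLaw_le _ _ _
    _ ≤ ENNReal.ofReal (Real.log (n + 1 : ℕ)) + (ENNReal.ofReal (Real.log (n + 1 : ℕ)) +
          capacityPerUnitCost (runChannel D hD) (runCost D) * n) := by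
        gcongr
        · simpa only [Finset.card_range] using mutualInfo_le_log_card hfst (convPow D)
        · refine (mutualInfo_listChannel_le _ (runCost_ne_zero D) hsnd
            (ne_top_of_le_ne_top (ENNReal.natCast_ne_top n) hruns)).trans ?_
          gcongr
    _ = _ := by ring

theorem mutualInfo_repeatChannel_le {D : PMF ℕ} (hD : D 0 ≠ 1) {n : ℕ} (P : PMF (Fin n → Bool)) :
    mutualInfo P (fun x => repeatChannel D (List.ofFn x)) ≤
      capacityPerUnitCost (runChannel D hD) (runCost D) * n +
        2 * ENNReal.ofReal (Real.log (n + 1 : ℕ)) := by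
  -- The preceding output run is fictitious; its value is arbitrary.
  simp only [repeatChannel_eq_runDecomposition_bind hD true]
  refine (mutualInfo_bind_input_le _ _ _).trans (mutualInfo_runOutput_le hD true ?_ ?_)
  · intro z hz
    obtain ⟨x, -, hx⟩ := (PMF.mem_support_bind_iff _ _ _).1 hz
    exact (add_length_le_of_mem_support_runDecomposition hx).trans_eq List.length_ofFn
  · simp only [expect_bind, expect_runDecomposition hD, List.length_ofFn, expect_const, le_refl]

theorem tendsto_log_succ_div_nat :
    Filter.Tendsto (fun n : ℕ => ENNReal.ofReal (Real.log (n + 1 : ℕ)) / n) Filter.atTop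
      (nhds 0) := by
  have hreal : Filter.Tendsto (fun n : ℕ => Real.log (n + 1 : ℕ) / n) Filter.atTop (nhds 0) := by
    have hsucc : (fun n : ℕ => ((n + 1 : ℕ) : ℝ)) =O[Filter.atTop] fun n : ℕ => (n : ℝ) := by
      refine Asymptotics.IsBigO.of_bound 2 ?_
      filter_upwards [Filter.eventually_ge_atTop 1] with n hn
      rw [Real.norm_natCast, Real.norm_natCast]
      exact_mod_cast (by lia : n + 1 ≤ 2 * n)
    exact ((Real.isLittleO_log_id_atTop.comp_tendsto (tendsto_natCast_atTop_atTop.comp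
      (Filter.tendsto_add_atTop_nat 1))).trans_isBigO hsucc).tendsto_div_nhds_zero
  refine (ENNReal.ofReal_zero ▸ ENNReal.tendsto_ofReal hreal).congr' ?_
  filter_upwards [Filter.eventually_gt_atTop 0] with n hn
  rw [ENNReal.ofReal_div_of_pos (Nat.cast_pos.2 hn), ENNReal.ofReal_natCast]

theorem capacity_le_capacityPerUnitCost {D : PMF ℕ} (hD : D 0 ≠ 1) :
    capacity D ≤ capacityPerUnitCost (runChannel D hD) (runCost D) := by
  set C := capacityPerUnitCost (runChannel D hD) (runCost D)
  have hlim : Filter.Tendsto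
      (fun n : ℕ => C + 2 * (ENNReal.ofReal (Real.log (n + 1 : ℕ)) / n)) Filter.atTop (nhds C) := by
    simpa only [mul_zero, add_zero] using
      (ENNReal.Tendsto.const_mul tendsto_log_succ_div_nat (.inr ENNReal.ofNat_ne_top)).const_add C
  refine (Filter.limsup_le_limsup (.of_forall fun n => ?_)).trans_eq hlim.limsup_eq
  calc maxInfo D n / n
      ≤ (C * n + 2 * ENNReal.ofReal (Real.log (n + 1 : ℕ))) / n := by
        gcongr
        exact iSup_le (mutualInfo_repeatChannel_le hD)
    _ = C * n / n + 2 * (ENNReal.ofReal (Real.log (n + 1 : ℕ)) / n) := by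
        rw [ENNReal.add_div, mul_div_assoc 2]
    _ ≤ C + 2 * (ENNReal.ofReal (Real.log (n + 1 : ℕ)) / n) := by
        gcongr
        exact ENNReal.div_le_of_le_mul le_rfl

theorem mutualInfo_runChannel_le_convolutionChannel {D : PMF ℕ} (hD : D 0 ≠ 1) (R : PMF ℕ+) :
    mutualInfo R (runChannel D hD) ≤ mutualInfo (R.map PNat.natPred) (convolutionChannel D) := by
  have hdegraded (z : ℕ+) : runChannel D hD z =
      (convPow D z.natPred).bind fun b => (condNonzero D hD).map fun a => a + b :=
    PMF.bind_comm _ _ _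
  rw [mutualInfo_map, funext hdegraded]
  exact mutualInfo_bind_output_le _ _ _

theorem mean_bind_convolutionChannel (D : PMF ℕ) (R : PMF ℕ) :
    mean (R.bind (convolutionChannel D)) = mean R * mean D := by
  simp only [mean_bind, Function.comp_def, convolutionChannel, mean_convPow, expect_mul_const]
  rfl

theorem mean_bind_runChannel {D : PMF ℕ} (hD : D 0 ≠ 1) (R : PMF ℕ+) :
    mean (R.bind (runChannel D hD)) =
      mean (condNonzero D hD) + mean (R.map PNat.natPred) * mean D := by
  rw [← mean_bind_convolutionChannel, mean_bind, mean_bind, expect_map, ← expect_const R (mean _),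
    ← expect_add]
  exact expect_congr fun z _ => mean_conv _ _

theorem expect_runCost (D : PMF ℕ) (R : PMF ℕ+) :
    expect R (runCost D) = (retentionProb D)⁻¹ + mean (R.map PNat.natPred) := by
  unfold runCost
  rw [expect_add, expect_const]
  exact congrArg _ (expect_map R PNat.natPred _).symm

theorem capacityPerUnitCost_le_iSup_runChannel {D : PMF ℕ} (hD : D 0 ≠ 1) (hmean : mean D ≠ ∞) :
    capacityPerUnitCost (runChannel D hD) (runCost D) ≤
      ⨆ (μ : ℝ≥0) (_ : mean (condNonzero D hD) ≤ μ), meanLimitedCapacity (runChannel D hD) μ /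
        (1 / retentionProb D + ((μ : ℝ≥0∞) - mean (condNonzero D hD)) / mean D) := by
  refine iSup₂_le fun R hR => ?_
  rw [expect_runCost] at hR ⊢
  have hR' := (ENNReal.add_ne_top.1 hR).2
  have hcond := mean_condNonzero_ne_top hD hmean
  have hout := mean_bind_runChannel hD R
  have hcost : 1 / retentionProb D +
      (mean (R.bind (runChannel D hD)) - mean (condNonzero D hD)) / mean D =
        (retentionProb D)⁻¹ + mean (R.map PNat.natPred) := by
    rw [hout, ENNReal.add_sub_cancel_left hcond,
      ENNReal.mul_div_cancel_right (mean_ne_zero hD) hmean, one_div]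
  obtain ⟨μ, hμ⟩ : ∃ μ : ℝ≥0, mean (R.bind (runChannel D hD)) = μ :=
    ⟨_, (ENNReal.coe_toNNReal (by rw [hout]; finiteness)).symm⟩
  rw [← hcost, hμ]
  refine le_iSup₂_of_le μ (by rw [← hμ, hout]; exact le_self_add) (ENNReal.div_le_div_right ?_ _)
  exact le_iSup₂_of_le R hμ le_rfl

theorem capacityPerUnitCost_le_iSup_convolutionChannel {D : PMF ℕ} (hD : D 0 ≠ 1)
    (hmean : mean D ≠ ∞) :
    capacityPerUnitCost (runChannel D hD) (runCost D) ≤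
      ⨆ μ : ℝ≥0, meanLimitedCapacity (convolutionChannel D) μ /
        (1 / retentionProb D + (μ : ℝ≥0∞) / mean D) := by
  refine iSup₂_le fun R hR => ?_
  rw [expect_runCost] at hR ⊢
  have hR' := (ENNReal.add_ne_top.1 hR).2
  have hout := mean_bind_convolutionChannel D (R.map PNat.natPred)
  have hcost : 1 / retentionProb D +
      mean ((R.map PNat.natPred).bind (convolutionChannel D)) / mean D =
        (retentionProb D)⁻¹ + mean (R.map PNat.natPred) := by
    rw [hout, ENNReal.mul_div_cancel_right (mean_ne_zero hD) hmean, one_div]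
  obtain ⟨μ, hμ⟩ : ∃ μ : ℝ≥0, mean ((R.map PNat.natPred).bind (convolutionChannel D)) = μ :=
    ⟨_, (ENNReal.coe_toNNReal (by rw [hout]; finiteness)).symm⟩
  rw [← hcost, hμ]
  refine le_iSup_of_le μ (ENNReal.div_le_div_right ?_ _)
  exact (mutualInfo_runChannel_le_convolutionChannel hD R).trans
    (le_iSup₂_of_le (R.map PNat.natPred) hμ le_rfl)

end

end RepeatChannel

theorem mainTheorem3 (D : PMF ℕ) (hD : D 0 ≠ 1) (hmean : RepeatChannel.mean D ≠ ∞) :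
    RepeatChannel.capacity D ≤
        ⨆ (μ : ℝ≥0) (_ : RepeatChannel.mean (RepeatChannel.condNonzero D hD) ≤ (μ : ℝ≥0∞)),
          RepeatChannel.meanLimitedCapacity (RepeatChannel.runChannel D hD) μ /
            (1 / RepeatChannel.retentionProb D +
              ((μ : ℝ≥0∞) - RepeatChannel.mean (RepeatChannel.condNonzero D hD)) /
                RepeatChannel.mean D) ∧
      RepeatChannel.capacity D ≤
        ⨆ μ : ℝ≥0,
          RepeatChannel.meanLimitedCapacity (RepeatChannel.convolutionChannel D) μ /
            (1 / RepeatChannel.retentionProb D + (μ : ℝ≥0∞) / RepeatChannel.mean D) := by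
  have hcap := RepeatChannel.capacity_le_capacityPerUnitCost hD
  exact ⟨hcap.trans (RepeatChannel.capacityPerUnitCost_le_iSup_runChannel hD hmean),
    hcap.trans (RepeatChannel.capacityPerUnitCost_le_iSup_convolutionChannel hD hmean)⟩
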